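/- Let $\{\mathcal A_n\}_{n\ge1}$ be a sequence of partitions of $[0,1)$ into intervals of the form $[\alpha,\beta)$ such that (1) $\mathcal A_1=\{[0,1)\}$; (2) for each $n\ge1$, $\mathcal A_{n+1}$ is obtained from $\mathcal A_n$ by dividing exactly one interval of $\mathcal A_n$ into two nonempty intervals and keeping the others; (3) $\max_{A\in\mathcal A_n}|A|\to0$ as $n\to\infty$. A *generalized Haar system* is a sequence $\mathcal H=\{f_n\}_{n\ge1}$ of real functions on $[0,1)$ such that, for some such $\{\mathcal A_n\}$, every $f_n$ is constant on each $A\in\mathcal A_n$, $\int_A f_n=0$ for all $A\in\mathcal A_{n-1}$, $n\ge2$, and $\|f_n\|_{L^2(0,1)}=1$ for all $n\ge 1$. For an infinite orthogonal system $\Phi=\{\phi_j\}_{j\ge1}\subset L^2(0,1)$ and $n\ge 1$ put $$\kappa_n(\Phi)=\sup\frac{\bigl\|\max_{1\le m\le n}|p_m|\bigr\|_2}{\|p_n\|_2},$$ where the supremum is taken over all sequences $p_k=\sum_{j\in G_k}c_j\phi_j$, $k=1,\dots,n$, with finite sets $G_1\subset G_2\subset\dots\subset G_n\subset\mathbb N$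 and real numbers $c_j$ such that $\sum_{j\in G_n}c_j^2\ne0$. **Theorem.** There are absolute constants $c_1,c_2>0$ such that for every generalized Haar system $\mathcal H$ and every integer $n\ge2$, $$c_1\sqrt{\log_2 n}\le\kappa_n(\mathcal H)\le c_2\sqrt{\log_2 n}.$$ -/

import Mathlib

open MeasureTheory Filter Topology
open scoped ENNReal

noncomputable section

/-- The `L²(0,1)` norm of a real function (as an extended nonnegative real). -/
def norm2 (f : ℝ → ℝ) : ℝ≥0∞ :=
  eLpNorm f 2 (volume.restrict (Set.Ico (0 : ℝ) 1))

/-- The `Φ`-polynomial `∑_{j ∈ G} c_j φ_j`. -/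
def poly (Φ : ℕ → ℝ → ℝ) (c : ℕ → ℝ) (G : Finset ℕ) (x : ℝ) : ℝ :=
  ∑ j ∈ G, c j * Φ j x

/-- `κ_n(Φ)`, for `n ≥ 1`: the supremum of `‖max_{1 ≤ m ≤ n} |p_m|‖₂ / ‖p_n‖₂` over all monotonic
sequences `p_k = ∑_{j ∈ G_k} c_j φ_j`, `k = 1, …, n`, with `G_1 ⊆ ⋯ ⊆ G_n` finite sets of indices
and `∑_{j ∈ G_n} c_j² ≠ 0`. Only the values `G 1, …, G n` matter. -/
def kappa (Φ : ℕ → ℝ → ℝ) (n : ℕ) : ℝ≥0∞ :=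
  ⨆ (G : ℕ → Finset ℕ) (c : ℕ → ℝ)
    (_ : MonotoneOn G (Set.Icc 1 n)) (_ : ∑ j ∈ G n, c j ^ 2 ≠ 0),
    norm2 (fun x => ⨆ m : Set.Icc 1 n, |poly Φ c (G m) x|) / norm2 (poly Φ c (G n))

/-- A binary filtration of `[0,1)` by intervals with mesh tending to zero: it starts from the
trivial partition, each partition arises from the preceding one by dividing exactly one of its
intervals into two (nonempty) children intervals, and the maximal length of the intervals tends
to zero. The partitions are indexed from `0`. -/
structure IsBinaryFiltration (𝒜 : ℕ → Set (Set ℝ)) : Prop where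
  zero : 𝒜 0 = {Set.Ico 0 1}
  succ : ∀ n, ∃ a t b : ℝ, a < t ∧ t < b ∧ Set.Ico a b ∈ 𝒜 n ∧
    𝒜 (n + 1) = (𝒜 n \ {Set.Ico a b}) ∪ {Set.Ico a t, Set.Ico t b}
  mesh : Tendsto (fun n => ⨆ A ∈ 𝒜 n, volume A) atTop (𝓝 0)

/-- `f` is a martingale difference based on the sequence of partitions `𝒜`. -/
structure IsMartingaleDifference (𝒜 : ℕ → Set (Set ℝ)) (f : ℕ → ℝ → ℝ) : Prop where
  integrable : ∀ n, IntegrableOn (f n) (Set.Ico 0 1)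
  const : ∀ n, ∀ A ∈ 𝒜 n, ∃ v : ℝ, ∀ x ∈ A, f n x = v
  mean_zero : ∀ n, ∀ A ∈ 𝒜 n, ∫ x in A, f (n + 1) x = 0

/-- A generalized Haar system: an `L²`-normalized martingale difference based on a binary
filtration of `[0,1)` by intervals with mesh tending to zero. -/
def IsGeneralizedHaarSystem (H : ℕ → ℝ → ℝ) : Prop :=
  ∃ 𝒜 : ℕ → Set (Set ℝ), IsBinaryFiltration 𝒜 ∧ IsMartingaleDifference 𝒜 H ∧
    ∀ n, norm2 (H n) = 1

end

/-!
# Maximal functions of monotone sequences of generalized Haar polynomials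

**Upper bound.** Let `X` be the vector of the `n` polynomials `p_1, …, p_n`, and let `N` be the
`ℓ^{2q}` norm on `ℝⁿ` with `2 ^ q ≥ n`, `q ≈ log₂ n`, which dominates the maximum of the
coordinates. Adding the `j`-th Haar function to all the polynomials whose spectrum contains it
changes `X` by a martingale difference `H_j w`, where the vector `w` has coordinates `0` and `c_j`,
so that `N(w)² ≤ n^{1/q} c_j² ≤ 2 c_j²`. As `N` is 2-smooth with constant of order `q`
(`evenNorm_two_smooth`), the integral of `N(X)²` grows by at most a multiple of `q c_j²`
(`integral_evenNorm_sq_add_le`). Summing over `j` bounds the square of the norm of the maximal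
function by a multiple of `q ∑ c_j² = q ‖p_n‖²` (`kappa_le`).

**Lower bound.** Since the mesh tends to zero, some set `E` made of intervals of a late partition
occupies a proportion between `1/4` and `3/4` of each interval of `𝒜 N`
(`IsBinaryFiltration.exists_half`). The first Haar functions span all step functions
(`IsMartingaleDifference.exists_eq_poly`), so the projection of the indicator of `E` on the
orthogonal complement of the step functions of `𝒜 N` is a polynomial with frequencies above `N`; it
has norm at most `1` and integral at least `1/8` over `E` (`exists_block`). Stacking `K` such blocks
gives a sum of norm at most `√K`. Every later Haar function lives on `E` or off `E`, so the terms may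
be reordered: first those of the later blocks that live off `E`, then the first block, then the
terms that live on `E`, and so on recursively. On `E` the partial sums thus pick up the first block,
and off `E` they may stop before it, whence the maximal function has integral at least `K / 8`
(`exists_monotone_family`). Only `2 ^ K ≤ n` partial sums are involved, so that `K` is of order
`log₂ n` (`le_kappa`).
-/

/-! ### Binary filtrations, step functions and orthogonality -/

namespace IsBinaryFiltration

variable {𝒜 : ℕ → Set (Set ℝ)}

lemma exists_eq_Ico (h : IsBinaryFiltration 𝒜) (n : ℕ) :
    ∀ A ∈ 𝒜 n, ∃ a b : ℝ, a < b ∧ A = Set.Ico a b := by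
  induction n with
  | zero =>
    intro A hA
    rw [h.zero] at hA
    exact ⟨0, 1, one_pos, hA⟩
  | succ n ih =>
    intro A hA
    obtain ⟨a, t, b, hat, htb, -, hn⟩ := h.succ n
    rw [hn] at hA
    rcases hA with hA | rfl | rfl
    · exact ih A hA.1
    · exact ⟨a, t, hat, rfl⟩
    · exact ⟨t, b, htb, rfl⟩

lemma finite (h : IsBinaryFiltration 𝒜) (n : ℕ) : (𝒜 n).Finite := by
  induction n with
  | zero => rw [h.zero]; exact Set.finite_singleton _
  | succ n ih =>
    obtain ⟨a, t, b, hat, htb, -, hn⟩ := h.succ n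
    rw [hn]
    exact (ih.subset Set.sdiff_subset).union ((Set.finite_singleton _).insert _)

lemma pairwiseDisjoint (h : IsBinaryFiltration 𝒜) (n : ℕ) : (𝒜 n).PairwiseDisjoint id := by
  induction n with
  | zero => rw [h.zero]; exact Set.pairwiseDisjoint_singleton _ _
  | succ n ih =>
    obtain ⟨a, t, b, hat, htb, hab, hn⟩ := h.succ n
    have hl : Set.Ico a t ⊆ Set.Ico a b := Set.Ico_subset_Ico_right htb.le
    have hr : Set.Ico t b ⊆ Set.Ico a b := Set.Ico_subset_Ico_left hat.le
    have key : ∀ B ∈ 𝒜 n \ {Set.Ico a b}, Disjoint B (Set.Ico a b) :=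
      fun B hB => ih hB.1 hab fun e => hB.2 e
    have hlr : Disjoint (Set.Ico a t) (Set.Ico t b) := by
      rw [Set.disjoint_left]
      intro x hx hx'
      exact absurd hx.2 (not_lt.mpr hx'.1)
    intro A hA B hB hne
    rw [hn] at hA hB
    simp only [Function.onFun, id]
    rcases hA with hA | rfl | rfl <;> rcases hB with hB | rfl | rfl
    · exact ih hA.1 hB.1 hne
    · exact (key A hA).mono_right hl
    · exact (key A hA).mono_right hr
    · exact ((key B hB).mono_right hl).symm
    · exact absurd rfl hne
    · exact hlr
    · exact ((key B hB).mono_right hr).symm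
    · exact hlr.symm
    · exact absurd rfl hne

lemma sUnion_eq (h : IsBinaryFiltration 𝒜) (n : ℕ) : ⋃₀ 𝒜 n = Set.Ico 0 1 := by
  induction n with
  | zero => rw [h.zero]; exact Set.sUnion_singleton _
  | succ n ih =>
    obtain ⟨a, t, b, hat, htb, hab, hn⟩ := h.succ n
    rw [← ih, hn, Set.sUnion_union, Set.sUnion_pair, Set.Ico_union_Ico_eq_Ico hat.le htb.le,
      ← Set.sUnion_singleton (Set.Ico a b), ← Set.sUnion_union, Set.sUnion_singleton,
      Set.sdiff_union_of_subset (Set.singleton_subset_iff.mpr hab)]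

lemma subset_Ico (h : IsBinaryFiltration 𝒜) {n : ℕ} {A : Set ℝ} (hA : A ∈ 𝒜 n) :
    A ⊆ Set.Ico 0 1 :=
  h.sUnion_eq n ▸ Set.subset_sUnion_of_mem hA

lemma exists_mem (h : IsBinaryFiltration 𝒜) (n : ℕ) {x : ℝ} (hx : x ∈ Set.Ico (0 : ℝ) 1) :
    ∃ A ∈ 𝒜 n, x ∈ A := by
  rwa [← h.sUnion_eq n] at hx

lemma measurableSet (h : IsBinaryFiltration 𝒜) {n : ℕ} {A : Set ℝ} (hA : A ∈ 𝒜 n) :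
    MeasurableSet A := by
  obtain ⟨a, b, -, rfl⟩ := h.exists_eq_Ico n A hA
  exact measurableSet_Ico

lemma volume_ne_top (h : IsBinaryFiltration 𝒜) {n : ℕ} {A : Set ℝ} (hA : A ∈ 𝒜 n) :
    volume A ≠ ∞ := by
  obtain ⟨a, b, -, rfl⟩ := h.exists_eq_Ico n A hA
  simp

lemma volume_real_pos (h : IsBinaryFiltration 𝒜) {n : ℕ} {A : Set ℝ} (hA : A ∈ 𝒜 n) :
    0 < volume.real A := by
  obtain ⟨a, b, hab, rfl⟩ := h.exists_eq_Ico n A hA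
  simpa [Real.volume_real_Ico_of_le hab.le] using hab

/-- The partitions refine one another. -/
lemma exists_superset (h : IsBinaryFiltration 𝒜) {m n : ℕ} (hmn : m ≤ n) :
    ∀ B ∈ 𝒜 n, ∃ A ∈ 𝒜 m, B ⊆ A := by
  induction n, hmn using Nat.le_induction with
  | base => exact fun B hB => ⟨B, hB, subset_rfl⟩
  | succ n _ ih =>
    intro B hB
    obtain ⟨a, t, b, hat, htb, hab, hn⟩ := h.succ n
    rw [hn] at hB
    rcases hB with hB | rfl | rfl
    · exact ih B hB.1
    · obtain ⟨A, hA, hsub⟩ := ih _ hab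
      exact ⟨A, hA, (Set.Ico_subset_Ico_right htb.le).trans hsub⟩
    · obtain ⟨A, hA, hsub⟩ := ih _ hab
      exact ⟨A, hA, (Set.Ico_subset_Ico_left hat.le).trans hsub⟩

lemma integral_eq_sum (h : IsBinaryFiltration 𝒜) (n : ℕ) {f : ℝ → ℝ}
    (hf : IntegrableOn f (Set.Ico 0 1)) :
    ∫ x in Set.Ico 0 1, f x = ∑ A ∈ (h.finite n).toFinset, ∫ x in A, f x := by
  have hU : Set.Ico (0 : ℝ) 1 = ⋃ A ∈ (h.finite n).toFinset, A := by
    rw [← h.sUnion_eq n, Set.sUnion_eq_biUnion]; simp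
  rw [hU, integral_biUnion_finset]
  · intro A hA
    exact h.measurableSet ((h.finite n).mem_toFinset.mp hA)
  · intro A hA B hB hne
    exact h.pairwiseDisjoint n ((h.finite n).mem_toFinset.mp hA)
      ((h.finite n).mem_toFinset.mp hB) hne
  · intro A hA
    exact hf.mono_set (h.subset_Ico ((h.finite n).mem_toFinset.mp hA))

lemma integral_mono (h : IsBinaryFiltration 𝒜) (n : ℕ) {f g : ℝ → ℝ}
    (hf : IntegrableOn f (Set.Ico 0 1)) (hg : IntegrableOn g (Set.Ico 0 1))
    (hfg : ∀ A ∈ 𝒜 n, ∫ x in A, f x ≤ ∫ x in A, g x) :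
    ∫ x in Set.Ico 0 1, f x ≤ ∫ x in Set.Ico 0 1, g x := by
  rw [h.integral_eq_sum n hf, h.integral_eq_sum n hg]
  exact Finset.sum_le_sum fun A hA => hfg A ((h.finite n).mem_toFinset.mp hA)

end IsBinaryFiltration

/-- `f` is constant on each interval of the partition `𝒜 n`. -/
def IsStepAt {β : Type*} (𝒜 : ℕ → Set (Set ℝ)) (n : ℕ) (f : ℝ → β) : Prop :=
  ∀ A ∈ 𝒜 n, ∃ v : β, ∀ x ∈ A, f x = v

namespace IsStepAt

variable {𝒜 : ℕ → Set (Set ℝ)} {β γ δ : Type*} {n : ℕ}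

lemma comp {f : ℝ → β} (hf : IsStepAt 𝒜 n f) (F : β → γ) : IsStepAt 𝒜 n (fun x => F (f x)) := by
  intro A hA
  obtain ⟨v, hv⟩ := hf A hA
  exact ⟨F v, fun x hx => by simp only [hv x hx]⟩

lemma comp₂ {f : ℝ → β} {g : ℝ → γ} (hf : IsStepAt 𝒜 n f) (hg : IsStepAt 𝒜 n g)
    (F : β → γ → δ) : IsStepAt 𝒜 n (fun x => F (f x) (g x)) := by
  intro A hA
  obtain ⟨v, hv⟩ := hf A hA
  obtain ⟨w, hw⟩ := hg A hA
  exact ⟨F v w, fun x hx => by simp only [hv x hx, hw x hx]⟩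

lemma pi {ι : Type*} {f : ι → ℝ → β} (hf : ∀ i, IsStepAt 𝒜 n (f i)) :
    IsStepAt 𝒜 n (fun x i => f i x) := by
  intro A hA
  choose v hv using fun i => hf i A hA
  exact ⟨v, fun x hx => funext fun i => hv i x hx⟩

lemma sum {ι : Type*} {f : ι → ℝ → ℝ} {s : Finset ι} (hf : ∀ i ∈ s, IsStepAt 𝒜 n (f i)) :
    IsStepAt 𝒜 n (fun x => ∑ i ∈ s, f i x) := by
  intro A hA
  choose! v hv using fun i hi => hf i hi A hA
  exact ⟨∑ i ∈ s, v i, fun x hx => Finset.sum_congr rfl fun i hi => hv i hi x hx⟩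

lemma mono (h : IsBinaryFiltration 𝒜) {f : ℝ → β} {m : ℕ} (hf : IsStepAt 𝒜 n f) (hnm : n ≤ m) :
    IsStepAt 𝒜 m f := by
  intro B hB
  obtain ⟨A, hA, hBA⟩ := h.exists_superset hnm B hB
  obtain ⟨v, hv⟩ := hf A hA
  exact ⟨v, fun x hx => hv x (hBA hx)⟩

lemma integrableOn (h : IsBinaryFiltration 𝒜) {f : ℝ → ℝ} (hf : IsStepAt 𝒜 n f) :
    IntegrableOn f (Set.Ico 0 1) := by
  rw [← h.sUnion_eq n, Set.sUnion_eq_biUnion, integrableOn_finite_biUnion (h.finite n)]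
  intro A hA
  obtain ⟨v, hv⟩ := hf A hA
  exact (integrableOn_const (h.volume_ne_top hA) (C := v)).congr_fun
    (fun x hx => (hv x hx).symm) (h.measurableSet hA)

lemma memLp_two (h : IsBinaryFiltration 𝒜) {f : ℝ → ℝ} (hf : IsStepAt 𝒜 n f) :
    MemLp f 2 (volume.restrict (Set.Ico 0 1)) :=
  (memLp_two_iff_integrable_sq (hf.integrableOn h).aestronglyMeasurable).2
    ((hf.comp (· ^ 2)).integrableOn h)

lemma norm2_eq (h : IsBinaryFiltration 𝒜) {f : ℝ → ℝ} (hf : IsStepAt 𝒜 n f) :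
    norm2 f = ENNReal.ofReal (Real.sqrt (∫ x in Set.Ico 0 1, f x ^ 2)) := by
  rw [norm2, (hf.memLp_two h).eLpNorm_eq_integral_rpow_norm two_ne_zero ENNReal.ofNat_ne_top,
    Real.sqrt_eq_rpow]
  simp

end IsStepAt

namespace IsMartingaleDifference

variable {𝒜 : ℕ → Set (Set ℝ)} {H : ℕ → ℝ → ℝ}

lemma isStepAt (h : IsBinaryFiltration 𝒜) (hH : IsMartingaleDifference 𝒜 H) {j n : ℕ}
    (hj : j ≤ n) : IsStepAt 𝒜 n (H j) :=
  IsStepAt.mono h (hH.const j) hj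

lemma isStepAt_poly (h : IsBinaryFiltration 𝒜) (hH : IsMartingaleDifference 𝒜 H) {n : ℕ}
    {G : Finset ℕ} (hG : ∀ j ∈ G, j ≤ n) (c : ℕ → ℝ) : IsStepAt 𝒜 n (poly H c G) :=
  IsStepAt.sum fun j hj => (hH.isStepAt h (hG j hj)).comp (c j * ·)

/-- A martingale difference is orthogonal to every function measurable with respect to the
preceding partition. -/
lemma integral_mul_eq_zero (h : IsBinaryFiltration 𝒜) (hH : IsMartingaleDifference 𝒜 H) {n j : ℕ}
    (hj : n < j) {f : ℝ → ℝ} (hf : IsStepAt 𝒜 n f) :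
    ∫ x in Set.Ico 0 1, f x * H j x = 0 := by
  obtain ⟨k, rfl⟩ : ∃ k, j = k + 1 := ⟨j - 1, by omega⟩
  have hint := ((hf.mono h hj.le).comp₂ (hH.const (k + 1)) (· * ·)).integrableOn h
  rw [h.integral_eq_sum k hint]
  refine Finset.sum_eq_zero fun A hA => ?_
  have hA := (h.finite k).mem_toFinset.mp hA
  obtain ⟨v, hv⟩ := hf.mono h (Nat.lt_succ_iff.mp hj) A hA
  rw [setIntegral_congr_fun (h.measurableSet hA) (g := fun x => v * H (k + 1) x)
    (fun x hx => by simp only [hv x hx]), integral_const_mul, hH.mean_zero k A hA, mul_zero]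

lemma integral_sq_eq_one (h : IsBinaryFiltration 𝒜) (hH : IsMartingaleDifference 𝒜 H) {n : ℕ}
    (hn : norm2 (H n) = 1) : ∫ x in Set.Ico 0 1, H n x ^ 2 = 1 := by
  rw [IsStepAt.norm2_eq h (hH.const n), ENNReal.ofReal_eq_one, Real.sqrt_eq_one] at hn
  exact hn

lemma integral_mul (h : IsBinaryFiltration 𝒜) (hH : IsMartingaleDifference 𝒜 H)
    (hn : ∀ n, norm2 (H n) = 1) (i j : ℕ) :
    ∫ x in Set.Ico 0 1, H i x * H j x = if i = j then 1 else 0 := by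
  rcases lt_trichotomy i j with hij | rfl | hij
  · rw [if_neg hij.ne, hH.integral_mul_eq_zero h hij (hH.const i)]
  · simp only [if_true, ← sq]
    exact hH.integral_sq_eq_one h (hn i)
  · rw [if_neg hij.ne']
    simp only [mul_comm (H i _)]
    exact hH.integral_mul_eq_zero h hij (hH.const j)

lemma integrableOn_poly_mul (h : IsBinaryFiltration 𝒜) (hH : IsMartingaleDifference 𝒜 H)
    (c : ℕ → ℝ) (G : Finset ℕ) (j : ℕ) :
    IntegrableOn (fun x => poly H c G x * H j x) (Set.Ico 0 1) :=
  (((hH.isStepAt_poly h (fun _ hi => (Finset.le_sup (f := id) hi).trans (le_max_left _ j)) c).comp₂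
    (hH.isStepAt h (le_max_right _ j))) (· * ·)).integrableOn h

lemma integral_poly_mul (h : IsBinaryFiltration 𝒜) (hH : IsMartingaleDifference 𝒜 H)
    (hn : ∀ n, norm2 (H n) = 1) (c : ℕ → ℝ) (G : Finset ℕ) (j : ℕ) :
    ∫ x in Set.Ico 0 1, poly H c G x * H j x = if j ∈ G then c j else 0 := by
  have hint : ∀ i ∈ G, IntegrableOn (fun x => c i * (H i x * H j x)) (Set.Ico 0 1) := fun i _ =>
    ((((hH.isStepAt h (le_max_left i j)).comp₂ (hH.isStepAt h (le_max_right i j)))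
      (· * ·)).comp (c i * ·)).integrableOn h
  simp only [poly, Finset.sum_mul, mul_assoc]
  rw [integral_finsetSum _ hint]
  simp only [integral_const_mul, hH.integral_mul h hn]
  simp

lemma integral_poly_mul_poly (h : IsBinaryFiltration 𝒜) (hH : IsMartingaleDifference 𝒜 H)
    (hn : ∀ n, norm2 (H n) = 1) (c d : ℕ → ℝ) (G G' : Finset ℕ) :
    ∫ x in Set.Ico 0 1, poly H c G x * poly H d G' x = ∑ j ∈ G', if j ∈ G then c j * d j else 0 := by
  have hint : ∀ j ∈ G', IntegrableOn (fun x => d j * (poly H c G x * H j x)) (Set.Ico 0 1) :=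
    fun j _ => (hH.integrableOn_poly_mul h c G j).const_mul (d j)
  have hexp : ∀ x, poly H c G x * poly H d G' x = ∑ j ∈ G', d j * (poly H c G x * H j x) := by
    intro x
    rw [poly.eq_1 H d, Finset.mul_sum]
    exact Finset.sum_congr rfl fun j _ => by ring
  simp only [hexp]
  rw [integral_finsetSum _ hint]
  simp only [integral_const_mul, hH.integral_poly_mul h hn]
  exact Finset.sum_congr rfl fun j _ => by split_ifs <;> ring

lemma norm2_poly (h : IsBinaryFiltration 𝒜) (hH : IsMartingaleDifference 𝒜 H)
    (hn : ∀ n, norm2 (H n) = 1) (c : ℕ → ℝ) (G : Finset ℕ) :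
    norm2 (poly H c G) = ENNReal.ofReal (Real.sqrt (∑ j ∈ G, c j ^ 2)) := by
  rw [IsStepAt.norm2_eq h (hH.isStepAt_poly h (fun j hj => Finset.le_sup (f := id) hj) c)]
  simp only [sq]
  rw [hH.integral_poly_mul_poly h hn]
  congr 2
  exact Finset.sum_congr rfl fun j hj => if_pos hj

end IsMartingaleDifference

/-! ### Smoothness of the `ℓ^{2q}` norm and the upper bound -/

/-- Two-point hypercontractivity, with a non-optimal constant. The second inequality, on the odd
part of `(x + y) ^ (2 * q)`, is what makes the induction on `q` close. -/
lemma two_point_pow (x y C : ℝ) (q : ℕ) (hC : 4 * (q : ℝ) ≤ C) (hC1 : 1 ≤ C) :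
    (x + y) ^ (2 * q) + (x - y) ^ (2 * q) ≤ 2 * (x ^ 2 + C * y ^ 2) ^ q ∧
      x * y * ((x + y) ^ (2 * q) - (x - y) ^ (2 * q)) ≤
        4 * q * y ^ 2 * (x ^ 2 + C * y ^ 2) ^ q := by
  induction q with
  | zero => norm_num
  | succ q ih =>
    push_cast at hC ⊢
    obtain ⟨h1, h2⟩ := ih (by linarith)
    set Z := x ^ 2 + C * y ^ 2 with hZ
    have hy := sq_nonneg y
    have hx := sq_nonneg x
    have hXY : x ^ 2 + y ^ 2 ≤ Z := by nlinarith
    have hX : x ^ 2 ≤ Z := by nlinarith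
    have hZq : 0 ≤ Z ^ q := pow_nonneg (by linarith) q
    have e1 : (x + y) ^ (2 * (q + 1)) = (x + y) ^ (2 * q) * (x + y) ^ 2 := by ring
    have e2 : (x - y) ^ (2 * (q + 1)) = (x - y) ^ (2 * q) * (x - y) ^ 2 := by ring
    rw [e1, e2, pow_succ Z]
    set S := (x + y) ^ (2 * q)
    set T := (x - y) ^ (2 * q)
    constructor
    · have k1 : (x ^ 2 + y ^ 2) * (S + T) ≤ (x ^ 2 + y ^ 2) * (2 * Z ^ q) :=
        mul_le_mul_of_nonneg_left h1 (by linarith)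
      have k2 : (x ^ 2 + y ^ 2 + 4 * q * y ^ 2) * Z ^ q ≤ Z * Z ^ q :=
        mul_le_mul_of_nonneg_right (by rw [hZ]; nlinarith) hZq
      nlinarith
    · have k1 : (x ^ 2 + y ^ 2) * (x * y * (S - T)) ≤ (x ^ 2 + y ^ 2) * (4 * q * y ^ 2 * Z ^ q) :=
        mul_le_mul_of_nonneg_left h2 (by linarith)
      have k2 : (x ^ 2 + y ^ 2) * (4 * q * y ^ 2 * Z ^ q) ≤ Z * (4 * q * y ^ 2 * Z ^ q) :=
        mul_le_mul_of_nonneg_right hXY (by positivity)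
      have k3 : x ^ 2 * y ^ 2 * (S + T) ≤ x ^ 2 * y ^ 2 * (2 * Z ^ q) :=
        mul_le_mul_of_nonneg_left h1 (by positivity)
      have k4 : x ^ 2 * (y ^ 2 * Z ^ q) ≤ Z * (y ^ 2 * Z ^ q) :=
        mul_le_mul_of_nonneg_right hX (by positivity)
      nlinarith

/-- The `ℓ^{2q}` norm on a finite-dimensional space of real vectors. -/
noncomputable def evenNorm {ι : Type*} [Fintype ι] (q : ℕ) (x : ι → ℝ) : ℝ :=
  (∑ i, |x i| ^ ((2 * q : ℕ) : ℝ)) ^ (1 / ((2 * q : ℕ) : ℝ))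

section evenNorm

variable {ι : Type*} [Fintype ι] {q : ℕ}

lemma evenNorm_nonneg (x : ι → ℝ) : 0 ≤ evenNorm q x := by
  unfold evenNorm; positivity

lemma evenNorm_pow (hq : q ≠ 0) (x : ι → ℝ) : evenNorm q x ^ (2 * q) = ∑ i, x i ^ (2 * q) := by
  have h0 : ((2 * q : ℕ) : ℝ) ≠ 0 := by positivity
  rw [evenNorm, ← Real.rpow_natCast, ← Real.rpow_mul (by positivity), one_div,
    inv_mul_cancel₀ h0, Real.rpow_one]
  refine Finset.sum_congr rfl fun i _ => ?_
  rw [Real.rpow_natCast, (even_two_mul q).pow_abs]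

lemma evenNorm_add_le (hq : q ≠ 0) (x y : ι → ℝ) :
    evenNorm q (x + y) ≤ evenNorm q x + evenNorm q y := by
  refine Real.Lp_add_le Finset.univ x y ?_
  exact_mod_cast (by omega : 1 ≤ 2 * q)

lemma evenNorm_smul (hq : q ≠ 0) (a : ℝ) (x : ι → ℝ) :
    evenNorm q (a • x) = |a| * evenNorm q x := by
  have h2 : 2 * q ≠ 0 := by omega
  refine (pow_left_inj₀ (evenNorm_nonneg _)
    (mul_nonneg (abs_nonneg a) (evenNorm_nonneg _)) h2).mp ?_
  rw [mul_pow, evenNorm_pow hq, evenNorm_pow hq, (even_two_mul q).pow_abs, Finset.mul_sum]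
  exact Finset.sum_congr rfl fun i _ => by simp [mul_pow]

lemma abs_le_evenNorm (hq : q ≠ 0) (x : ι → ℝ) (i : ι) : |x i| ≤ evenNorm q x := by
  have h2 : 2 * q ≠ 0 := by omega
  refine (pow_le_pow_iff_left₀ (abs_nonneg _) (evenNorm_nonneg _) h2).mp ?_
  rw [evenNorm_pow hq, (even_two_mul q).pow_abs]
  exact Finset.single_le_sum (f := fun i => x i ^ (2 * q))
    (fun i _ => (even_two_mul q).pow_nonneg _) (Finset.mem_univ i)

lemma evenNorm_sq_le (hq : q ≠ 0) {x : ι → ℝ} {a : ℝ} (hx : ∀ i, x i ^ 2 ≤ a ^ 2)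
    (hcard : Fintype.card ι ≤ 2 ^ q) : evenNorm q x ^ 2 ≤ 2 * a ^ 2 := by
  refine (pow_le_pow_iff_left₀ (sq_nonneg _) (by positivity) hq).mp ?_
  rw [← pow_mul, evenNorm_pow hq, mul_pow]
  calc ∑ i, x i ^ (2 * q) ≤ ∑ _i : ι, (a ^ 2) ^ q := Finset.sum_le_sum fun i _ => by
        rw [pow_mul]; exact pow_le_pow_left₀ (sq_nonneg _) (hx i) q
    _ = Fintype.card ι * (a ^ 2) ^ q := by simp
    _ ≤ 2 ^ q * (a ^ 2) ^ q := by
        have : (Fintype.card ι : ℝ) ≤ 2 ^ q := by exact_mod_cast hcard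
        gcongr

lemma convexOn_evenNorm_sq (hq : q ≠ 0) (v w : ι → ℝ) :
    ConvexOn ℝ Set.univ (fun s : ℝ => evenNorm q (v + s • w) ^ 2) := by
  have hconv : ConvexOn ℝ Set.univ (fun s : ℝ => evenNorm q (v + s • w)) := by
    refine ⟨convex_univ, fun s _ t _ a b ha hb hab => ?_⟩
    have e : v + (a • s + b • t) • w = a • (v + s • w) + b • (v + t • w) := by
      ext i
      simp only [Pi.add_apply, Pi.smul_apply, smul_eq_mul]
      linear_combination -v i * hab
    simp only [e]
    refine (evenNorm_add_le hq _ _).trans ?_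
    rw [evenNorm_smul hq, evenNorm_smul hq, abs_of_nonneg ha, abs_of_nonneg hb]
    simp
  exact hconv.pow (fun s _ => evenNorm_nonneg _) 2

/-- The `ℓ^{2q}` norm is 2-smooth, with a constant of order `q`. -/
lemma evenNorm_two_smooth (hq : q ≠ 0) (x y : ι → ℝ) :
    evenNorm q (x + y) ^ 2 + evenNorm q (x - y) ^ 2 ≤
      2 * evenNorm q x ^ 2 + 8 * q * evenNorm q y ^ 2 := by
  have hq1 : (1 : ℝ) ≤ q := by exact_mod_cast Nat.one_le_iff_ne_zero.mpr hq
  have hq0 : (q : ℝ) ≠ 0 := by positivity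
  set R := evenNorm q x ^ 2 + 4 * q * evenNorm q y ^ 2 with hR
  have hR0 : 0 ≤ R := by positivity
  -- Minkowski's inequality in `ℓ^q` for the vectors of squares
  have mink : ∑ i, (x i ^ 2 + 4 * q * y i ^ 2) ^ q ≤ R ^ q := by
    have hM := Real.Lp_add_le_of_nonneg Finset.univ (p := (q : ℝ)) (f := fun i => x i ^ 2)
      (g := fun i => 4 * q * y i ^ 2) hq1 (fun i _ => sq_nonneg _) (fun i _ => by positivity)
    simp only [Real.rpow_natCast] at hM
    have root : ∀ z : ι → ℝ, (∑ i, (z i ^ 2) ^ q) ^ (1 / (q : ℝ)) = evenNorm q z ^ 2 := by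
      intro z
      have : ∑ i, (z i ^ 2) ^ q = (evenNorm q z ^ 2) ^ q := by
        rw [← pow_mul, evenNorm_pow hq]; simp only [pow_mul]
      rw [this, one_div, Real.pow_rpow_inv_natCast (sq_nonneg _) hq]
    have hy : (∑ i, (4 * (q : ℝ) * y i ^ 2) ^ q) ^ (1 / (q : ℝ)) =
        4 * q * evenNorm q y ^ 2 := by
      have : ∑ i, (4 * (q : ℝ) * y i ^ 2) ^ q = (4 * q * evenNorm q y ^ 2) ^ q := by
        rw [mul_pow _ (evenNorm q y ^ 2), ← pow_mul (evenNorm q y), evenNorm_pow hq,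
          Finset.mul_sum]
        simp only [mul_pow _ (_ ^ 2), pow_mul]
      rw [this, one_div, Real.pow_rpow_inv_natCast (by positivity) hq]
    rw [root, hy] at hM
    calc ∑ i, (x i ^ 2 + 4 * q * y i ^ 2) ^ q
        = ((∑ i, (x i ^ 2 + 4 * q * y i ^ 2) ^ q) ^ (1 / (q : ℝ))) ^ q := by
          rw [one_div, Real.rpow_inv_natCast_pow (Finset.sum_nonneg fun i _ => by positivity) hq]
      _ ≤ R ^ q := pow_le_pow_left₀
          (Real.rpow_nonneg (Finset.sum_nonneg fun i _ => by positivity) _) hM q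
  have key : (evenNorm q (x + y) ^ 2 + evenNorm q (x - y) ^ 2) ^ q ≤ (2 * R) ^ q := by
    calc (evenNorm q (x + y) ^ 2 + evenNorm q (x - y) ^ 2) ^ q
        ≤ 2 ^ (q - 1) * ((evenNorm q (x + y) ^ 2) ^ q + (evenNorm q (x - y) ^ 2) ^ q) :=
          add_pow_le (sq_nonneg _) (sq_nonneg _) q
      _ = 2 ^ (q - 1) * ∑ i, ((x i + y i) ^ (2 * q) + (x i - y i) ^ (2 * q)) := by
          rw [← pow_mul, ← pow_mul, evenNorm_pow hq, evenNorm_pow hq, Finset.sum_add_distrib]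
          rfl
      _ ≤ 2 ^ (q - 1) * ∑ i, 2 * (x i ^ 2 + 4 * q * y i ^ 2) ^ q := by
          gcongr with i
          exact (two_point_pow (x i) (y i) (4 * q) q le_rfl (by linarith)).1
      _ = 2 ^ q * ∑ i, (x i ^ 2 + 4 * q * y i ^ 2) ^ q := by
          rw [← Finset.mul_sum, ← mul_assoc, pow_sub_one_mul hq]
      _ ≤ (2 * R) ^ q := by rw [mul_pow]; gcongr
  have := (pow_le_pow_iff_left₀ (by positivity) (by positivity) hq).mp key
  rw [hR] at this
  linarith

end evenNorm

section Upper

variable {𝒜 : ℕ → Set (Set ℝ)} {H : ℕ → ℝ → ℝ} {ι : Type*} [Fintype ι] {q : ℕ}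

/-- Adding one martingale difference, in a fixed direction `w`, to an adapted vector process. -/
lemma integral_evenNorm_sq_add_le (h : IsBinaryFiltration 𝒜) (hH : IsMartingaleDifference 𝒜 H)
    (hn : ∀ n, norm2 (H n) = 1) (hq : q ≠ 0) {k : ℕ} {X : ℝ → ι → ℝ} (hX : IsStepAt 𝒜 k X)
    (w : ι → ℝ) :
    ∫ x in Set.Ico 0 1, evenNorm q (X x + H (k + 1) x • w) ^ 2 ≤
      (∫ x in Set.Ico 0 1, evenNorm q (X x) ^ 2) + 8 * q * evenNorm q w ^ 2 := by
  have hX' := hX.mono h (Nat.le_succ k)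
  have hd : IsStepAt 𝒜 (k + 1) (H (k + 1)) := hH.const (k + 1)
  have i1 := (hX'.comp₂ hd (fun a b => evenNorm q (a + b • w) ^ 2)).integrableOn h
  have i2 := (hX'.comp (fun a => evenNorm q a ^ 2)).integrableOn h
  have i3 := (hd.comp (fun b => 8 * q * evenNorm q w ^ 2 * b ^ 2)).integrableOn h
  have i4 := (hX'.comp₂ hd (fun a b => evenNorm q (a + (-b) • w) ^ 2)).integrableOn h
  have e : ∫ x in Set.Ico 0 1, (evenNorm q (X x) ^ 2 +
      8 * q * evenNorm q w ^ 2 * H (k + 1) x ^ 2) =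
      (∫ x in Set.Ico 0 1, evenNorm q (X x) ^ 2) + 8 * q * evenNorm q w ^ 2 := by
    rw [integral_add i2 i3, integral_const_mul, hH.integral_sq_eq_one h (hn _), mul_one]
  rw [← e]
  refine h.integral_mono k i1 (i2.add i3) fun A hA => ?_
  have hsub := h.subset_Ico hA
  have j1 := i1.mono_set hsub
  have j2 := i2.mono_set hsub
  have j3 := i3.mono_set hsub
  have j4 := i4.mono_set hsub
  -- 2-smoothness reduces the claim to a lower bound for the reflected increment
  have smooth : (∫ x in A, evenNorm q (X x + H (k + 1) x • w) ^ 2) +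
      ∫ x in A, evenNorm q (X x + (-H (k + 1) x) • w) ^ 2 ≤
      2 * (∫ x in A, evenNorm q (X x) ^ 2) +
        ∫ x in A, 8 * q * evenNorm q w ^ 2 * H (k + 1) x ^ 2 := by
    rw [← integral_add j1 j4, ← integral_const_mul, ← integral_add (j2.const_mul 2) j3]
    refine setIntegral_mono (j1.add j4) ((j2.const_mul 2).add j3) fun x => ?_
    have := evenNorm_two_smooth hq (X x) (H (k + 1) x • w)
    rw [evenNorm_smul hq, mul_pow, sq_abs] at this
    simp only [neg_smul, ← sub_eq_add_neg]
    linarith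
  -- the lower bound is Jensen's inequality, as the increment has mean zero on `A`
  have jensen : ∫ x in A, evenNorm q (X x) ^ 2 ≤
      ∫ x in A, evenNorm q (X x + (-H (k + 1) x) • w) ^ 2 := by
    obtain ⟨v, hv⟩ := hX A hA
    have hpos := h.volume_real_pos hA
    have hv0 : volume A ≠ 0 := fun h0 => by simp [Measure.real, h0] at hpos
    have hconv := convexOn_evenNorm_sq hq v w
    have hcont : ContinuousOn (fun s : ℝ => evenNorm q (v + s • w) ^ 2) Set.univ :=
      hconv.continuousOn isOpen_univ
    have j4' : IntegrableOn (fun x => evenNorm q (v + (-H (k + 1) x) • w) ^ 2) A :=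
      j4.congr_fun (fun x hx => by simp only [hv x hx]) (h.measurableSet hA)
    have J := hconv.map_set_average_le hcont isClosed_univ hv0 (h.volume_ne_top hA)
      (f := fun x => -H (k + 1) x) (by simp) ((hd.integrableOn h).mono_set hsub).neg j4'
    rw [setAverage_eq, setAverage_eq, integral_neg, hH.mean_zero k A hA] at J
    simp only [neg_zero, mul_zero, zero_smul, add_zero, smul_eq_mul] at J
    have r1 : ∫ x in A, evenNorm q (X x) ^ 2 = volume.real A * evenNorm q v ^ 2 := by
      rw [setIntegral_congr_fun (h.measurableSet hA) (g := fun _ => evenNorm q v ^ 2)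
        (fun x hx => by simp only [hv x hx]), setIntegral_const, smul_eq_mul]
    have r2 : ∫ x in A, evenNorm q (X x + (-H (k + 1) x) • w) ^ 2 =
        ∫ x in A, evenNorm q (v + (-H (k + 1) x) • w) ^ 2 :=
      setIntegral_congr_fun (h.measurableSet hA) fun x hx => by simp only [hv x hx]
    rw [r1, r2]
    calc _ ≤ _ := mul_le_mul_of_nonneg_left J hpos.le
      _ = _ := mul_inv_cancel_left₀ hpos.ne' _
  rw [integral_add j2 j3]
  linarith

/-- Simultaneous transforms of one martingale: the vector whose coordinates are the polynomials
`∑_{j ≤ N, j ∈ G i} c j * H j` satisfies a type 2 inequality. -/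
lemma integral_evenNorm_sq_poly_le (h : IsBinaryFiltration 𝒜) (hH : IsMartingaleDifference 𝒜 H)
    (hn : ∀ n, norm2 (H n) = 1) (hq : q ≠ 0) (hcard : Fintype.card ι ≤ 2 ^ q)
    (G : ι → Finset ℕ) (c : ℕ → ℝ) (N : ℕ) :
    ∫ x in Set.Ico 0 1, evenNorm q (fun i => poly H c ((Finset.range (N + 1)).filter (· ∈ G i)) x) ^ 2
      ≤ 16 * q * ∑ j ∈ Finset.range (N + 1), c j ^ 2 := by
  have hw : ∀ j, evenNorm q (fun i => if j ∈ G i then c j else 0) ^ 2 ≤ 2 * c j ^ 2 := fun j =>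
    evenNorm_sq_le hq (fun i => by split_ifs <;> simp [sq_nonneg]) hcard
  have hq1 : (1 : ℝ) ≤ q := by exact_mod_cast Nat.one_le_iff_ne_zero.mpr hq
  induction N with
  | zero =>
    have e : ∀ x, (fun i => poly H c ((Finset.range (0 + 1)).filter (· ∈ G i)) x) =
        H 0 x • (fun i => if 0 ∈ G i then c 0 else 0) := by
      intro x; ext i
      simp only [poly, Finset.sum_filter, zero_add, Finset.sum_range_one, Pi.smul_apply, smul_eq_mul]
      split_ifs <;> ring
    simp only [e, evenNorm_smul hq, mul_pow, sq_abs]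
    rw [integral_mul_const, hH.integral_sq_eq_one h (hn 0)]
    have := hw 0
    simp only [zero_add, Finset.range_one, Finset.sum_singleton]
    nlinarith [sq_nonneg (c 0)]
  | succ N ih =>
    have e : ∀ x, (fun i => poly H c ((Finset.range (N + 1 + 1)).filter (· ∈ G i)) x) =
        (fun i => poly H c ((Finset.range (N + 1)).filter (· ∈ G i)) x) +
        H (N + 1) x • (fun i => if N + 1 ∈ G i then c (N + 1) else 0) := by
      intro x; ext i
      simp only [poly, Finset.sum_filter, Pi.add_apply, Pi.smul_apply, smul_eq_mul]
      rw [Finset.sum_range_succ]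
      simp [mul_comm]
    simp only [e]
    have hstep := integral_evenNorm_sq_add_le h hH hn hq (k := N)
      (X := fun x i => poly H c ((Finset.range (N + 1)).filter (· ∈ G i)) x)
      (IsStepAt.pi fun i => hH.isStepAt_poly h (fun j hj => by
        simp only [Finset.mem_filter, Finset.mem_range] at hj; omega) c)
      (fun i => if N + 1 ∈ G i then c (N + 1) else 0)
    rw [Finset.sum_range_succ]
    nlinarith [hw (N + 1)]

lemma clog_le_two_mul_logb {n : ℕ} (hn : 2 ≤ n) : (Nat.clog 2 n : ℝ) ≤ 2 * Real.logb 2 n := by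
  have h1 : (1 : ℝ) ≤ Real.logb 2 n := by
    rw [Real.le_logb_iff_rpow_le one_lt_two (by positivity)]
    simpa using (by exact_mod_cast hn : (2 : ℝ) ≤ n)
  have h2 : (2 : ℝ) ^ (Nat.clog 2 n - 1) < n := by
    exact_mod_cast Nat.pow_pred_clog_lt_self one_lt_two hn
  have h3 : ((Nat.clog 2 n - 1 : ℕ) : ℝ) ≤ Real.logb 2 n := by
    rw [Real.le_logb_iff_rpow_le one_lt_two (by positivity), Real.rpow_natCast]
    exact h2.le
  have h4 : 1 ≤ Nat.clog 2 n := Nat.clog_pos one_lt_two hn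
  rw [Nat.cast_sub h4] at h3
  push_cast at h3
  linarith

lemma kappa_le (h : IsBinaryFiltration 𝒜) (hH : IsMartingaleDifference 𝒜 H)
    (hn : ∀ n, norm2 (H n) = 1) {n : ℕ} (h2 : 2 ≤ n) :
    kappa H n ≤ ENNReal.ofReal (6 * Real.sqrt (Real.logb 2 n)) := by
  refine iSup_le fun G => iSup_le fun c => iSup_le fun hG => iSup_le fun _ => ?_
  refine ENNReal.div_le_of_le_mul ?_
  set N := (G n).sup id with hN
  set q := Nat.clog 2 n with hqdef
  have hq : q ≠ 0 := (Nat.clog_pos one_lt_two h2).ne'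
  have hn1 : n ∈ Set.Icc 1 n := ⟨by omega, le_rfl⟩
  -- coefficients outside `G n` play no role, and may be set to zero
  set c' : ℕ → ℝ := fun j => if j ∈ G n then c j else 0 with hc'
  have hpoly : ∀ m : Set.Icc 1 n, ∀ x,
      poly H c' ((Finset.range (N + 1)).filter (· ∈ G m)) x = poly H c (G m) x := by
    intro m x
    have hsub : G m ⊆ G n := hG m.2 hn1 m.2.2
    have e : (Finset.range (N + 1)).filter (· ∈ G m) = G m := by
      ext j
      simp only [Finset.mem_filter, Finset.mem_range, and_iff_right_iff_imp]
      intro hj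
      exact Nat.lt_succ_of_le (Finset.le_sup (f := id) (hsub hj))
    rw [e]
    exact Finset.sum_congr rfl fun j hj => by simp [hc', hsub hj]
  have hsum : ∑ j ∈ Finset.range (N + 1), c' j ^ 2 = ∑ j ∈ G n, c j ^ 2 := by
    have hsub : G n ⊆ Finset.range (N + 1) := fun j hj =>
      Finset.mem_range.mpr (Nat.lt_succ_of_le (Finset.le_sup (f := id) hj))
    rw [← Finset.sum_subset hsub fun j _ hj => by simp [hc', hj]]
    exact Finset.sum_congr rfl fun j hj => by simp [hc', hj]
  have hcard : Fintype.card (Set.Icc 1 n) ≤ 2 ^ q := by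
    simpa using Nat.le_pow_clog one_lt_two n
  have hmain := integral_evenNorm_sq_poly_le h hH hn hq hcard (fun m => G m) c' N
  simp only [hpoly, hsum] at hmain
  have hstep : IsStepAt 𝒜 N (fun x => evenNorm q (fun m : Set.Icc 1 n => poly H c (G m) x)) :=
    (IsStepAt.pi fun m : Set.Icc 1 n => hH.isStepAt_poly h (fun j hj =>
      Finset.le_sup (f := id) (hG m.2 hn1 m.2.2 hj)) c).comp _
  have : Nonempty (Set.Icc 1 n) := ⟨⟨n, hn1⟩⟩
  calc norm2 (fun x => ⨆ m : Set.Icc 1 n, |poly H c (G m) x|)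
      ≤ norm2 (fun x => evenNorm q (fun m : Set.Icc 1 n => poly H c (G m) x)) := by
        refine eLpNorm_mono_real fun x => ?_
        rw [Real.norm_of_nonneg (Real.iSup_nonneg fun m => abs_nonneg _)]
        exact ciSup_le fun m => abs_le_evenNorm hq (fun m : Set.Icc 1 n => poly H c (G m) x) m
    _ = ENNReal.ofReal (Real.sqrt (∫ x in Set.Ico 0 1,
          evenNorm q (fun m : Set.Icc 1 n => poly H c (G m) x) ^ 2)) := hstep.norm2_eq h
    _ ≤ ENNReal.ofReal (6 * Real.sqrt (Real.logb 2 n) * Real.sqrt (∑ j ∈ G n, c j ^ 2)) := by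
        refine ENNReal.ofReal_le_ofReal ?_
        have hl := clog_le_two_mul_logb h2
        have hs : 0 ≤ ∑ j ∈ G n, c j ^ 2 := Finset.sum_nonneg fun j _ => sq_nonneg _
        have hl0 : 0 ≤ Real.logb 2 n := by
          have : (0 : ℝ) ≤ Nat.clog 2 n := Nat.cast_nonneg _
          linarith
        refine Real.sqrt_le_iff.mpr ⟨by positivity, hmain.trans ?_⟩
        rw [mul_pow, mul_pow, Real.sq_sqrt hl0, Real.sq_sqrt hs]
        refine mul_le_mul_of_nonneg_right ?_ hs
        rw [hqdef]
        linarith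
    _ = _ := by rw [hH.norm2_poly h hn, ENNReal.ofReal_mul (by positivity)]

end Upper

/-! ### Reordering blocks of Haar functions and the lower bound -/

section Lower

variable {𝒜 : ℕ → Set (Set ℝ)} {H : ℕ → ℝ → ℝ}

lemma IsBinaryFiltration.eq_of_mem (h : IsBinaryFiltration 𝒜) {n : ℕ} {A B : Set ℝ}
    (hA : A ∈ 𝒜 n) (hB : B ∈ 𝒜 n) {x : ℝ} (hxA : x ∈ A) (hxB : x ∈ B) : A = B :=
  (h.pairwiseDisjoint n).elim_set hA hB x hxA hxB

namespace IsMartingaleDifference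

lemma eq_zero_of_const (h : IsBinaryFiltration 𝒜) (hH : IsMartingaleDifference 𝒜 H) {k : ℕ}
    {A : Set ℝ} (hA : A ∈ 𝒜 k) {v : ℝ} (hv : ∀ x ∈ A, H (k + 1) x = v) : v = 0 := by
  have h0 := hH.mean_zero k A hA
  rw [setIntegral_congr_fun (h.measurableSet hA) (g := fun _ => v) hv, setIntegral_const,
    smul_eq_mul] at h0
  exact (mul_eq_zero.mp h0).resolve_left (h.volume_real_pos hA).ne'

/-- A martingale difference with respect to a binary filtration lives on the interval being
divided. -/
lemma exists_split (h : IsBinaryFiltration 𝒜) (hH : IsMartingaleDifference 𝒜 H) (k : ℕ) :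
    ∃ a t b : ℝ, a < t ∧ t < b ∧ Set.Ico a b ∈ 𝒜 k ∧
      𝒜 (k + 1) = (𝒜 k \ {Set.Ico a b}) ∪ {Set.Ico a t, Set.Ico t b} ∧
      ∀ x ∈ Set.Ico (0 : ℝ) 1, x ∉ Set.Ico a b → H (k + 1) x = 0 := by
  obtain ⟨a, t, b, hat, htb, hab, hn⟩ := h.succ k
  refine ⟨a, t, b, hat, htb, hab, hn, fun x hx hxab => ?_⟩
  obtain ⟨B, hB, hxB⟩ := h.exists_mem k hx
  have hB' : B ∈ 𝒜 (k + 1) := by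
    rw [hn]
    exact Or.inl ⟨hB, fun e => hxab (e ▸ hxB)⟩
  obtain ⟨v, hv⟩ := hH.const (k + 1) B hB'
  rw [hv x hxB, hH.eq_zero_of_const h hB hv]

/-- If `E` is a union of intervals of `𝒜 M`, each later martingale difference vanishes
either off `E` or on `E`. -/
lemma eq_zero_off_or_on (h : IsBinaryFiltration 𝒜) (hH : IsMartingaleDifference 𝒜 H) {M j : ℕ}
    (hj : M < j) {E : Set ℝ} (hE : E ⊆ Set.Ico 0 1) (hME : ∀ B ∈ 𝒜 M, B ⊆ E ∨ Disjoint B E) :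
    (∀ x ∈ Set.Ico (0 : ℝ) 1, x ∉ E → H j x = 0) ∨ ∀ x ∈ E, H j x = 0 := by
  obtain ⟨k, rfl⟩ : ∃ k, j = k + 1 := ⟨j - 1, by omega⟩
  obtain ⟨a, t, b, -, -, hab, -, h0⟩ := hH.exists_split h k
  obtain ⟨B, hB, hsub⟩ := h.exists_superset (Nat.lt_succ_iff.mp hj) _ hab
  rcases hME B hB with hBE | hBE
  · exact Or.inl fun x hx hxE => h0 x hx fun hxab => hxE (hBE (hsub hxab))
  · exact Or.inr fun x hx =>
      h0 x (hE hx) fun hxab => Set.disjoint_left.mp hBE (hsub hxab) hx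

/-- The first `M + 1` functions of a generalized Haar system span the step functions of the
partition `𝒜 M`. -/
lemma exists_eq_poly (h : IsBinaryFiltration 𝒜) (hH : IsMartingaleDifference 𝒜 H)
    (hn : ∀ n, norm2 (H n) = 1) (M : ℕ) :
    ∀ F : ℝ → ℝ, IsStepAt 𝒜 M F →
      ∃ c : ℕ → ℝ, ∀ x ∈ Set.Ico (0 : ℝ) 1, F x = poly H c (Finset.range (M + 1)) x := by
  have hne : ∀ n, ¬ ∀ x ∈ Set.Ico (0 : ℝ) 1, H n x = 0 := by
    intro n h0
    have h1 := hH.integral_sq_eq_one h (hn n)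
    rw [setIntegral_congr_fun measurableSet_Ico (g := fun _ => (0 : ℝ))
      (fun x hx => by simp [h0 x hx])] at h1
    simp at h1
  induction M with
  | zero =>
    intro F hF
    have hmem : Set.Ico (0 : ℝ) 1 ∈ 𝒜 0 := by rw [h.zero]; rfl
    obtain ⟨v, hv⟩ := hF _ hmem
    obtain ⟨u, hu⟩ := hH.const 0 _ hmem
    have hu0 : u ≠ 0 := by
      rintro rfl
      exact hne 0 hu
    refine ⟨fun _ => v / u, fun x hx => ?_⟩
    simp [poly, hv x hx, hu x hx, div_mul_cancel₀ _ hu0]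
  | succ k ih =>
    intro F hF
    obtain ⟨a, t, b, hat, htb, hab, hk, h0⟩ := hH.exists_split h k
    have hl : Set.Ico a t ∈ 𝒜 (k + 1) := by rw [hk]; simp
    have hr : Set.Ico t b ∈ 𝒜 (k + 1) := by rw [hk]; simp
    obtain ⟨vl, hvl⟩ := hF _ hl
    obtain ⟨vr, hvr⟩ := hF _ hr
    obtain ⟨ul, hul⟩ := hH.const (k + 1) _ hl
    obtain ⟨ur, hur⟩ := hH.const (k + 1) _ hr
    have hu : ul - ur ≠ 0 := by
      intro hu
      have hc : ∀ x ∈ Set.Ico a b, H (k + 1) x = ul := by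
        intro x hx
        rcases lt_or_ge x t with hxt | hxt
        · exact hul x ⟨hx.1, hxt⟩
        · rw [hur x ⟨hxt, hx.2⟩, sub_eq_zero.mp hu]
      have hz := hH.eq_zero_of_const h hab hc
      refine hne (k + 1) fun x hx => ?_
      by_cases hxab : x ∈ Set.Ico a b
      · rw [hc x hxab, hz]
      · exact h0 x hx hxab
    set s := (vl - vr) / (ul - ur) with hs
    have hsu : s * (ul - ur) = vl - vr := div_mul_cancel₀ _ hu
    obtain ⟨c, hc⟩ := ih (fun x => F x - s * H (k + 1) x) (by
      intro A hA
      by_cases hAab : A = Set.Ico a b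
      · subst hAab
        refine ⟨vl - s * ul, fun x hx => ?_⟩
        beta_reduce
        rcases lt_or_ge x t with hxt | hxt
        · rw [hvl x ⟨hx.1, hxt⟩, hul x ⟨hx.1, hxt⟩]
        · rw [hvr x ⟨hxt, hx.2⟩, hur x ⟨hxt, hx.2⟩]
          linarith
      · obtain ⟨v, hv⟩ := hF A (by rw [hk]; exact Or.inl ⟨hA, hAab⟩)
        refine ⟨v, fun x hx => ?_⟩
        beta_reduce
        rw [hv x hx, h0 x (h.subset_Ico hA hx) fun hxab => hAab (h.eq_of_mem hA hab hx hxab)]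
        ring)
    refine ⟨Function.update c (k + 1) s, fun x hx => ?_⟩
    have hcx := hc x hx
    have e : poly H (Function.update c (k + 1) s) (Finset.range (k + 1)) x =
        poly H c (Finset.range (k + 1)) x :=
      Finset.sum_congr rfl fun j hj => by
        rw [Function.update_of_ne (Finset.mem_range.mp hj).ne]
    rw [poly, Finset.sum_range_succ, ← poly, e, ← hcx, Function.update_self]
    ring

end IsMartingaleDifference

/-- Some later partition allows a set made of its intervals to take up roughly half of every
interval of `𝒜 N`. -/
lemma IsBinaryFiltration.exists_half (h : IsBinaryFiltration 𝒜) (N : ℕ) :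
    ∃ M, N ≤ M ∧ ∃ E : Set ℝ, E ⊆ Set.Ico 0 1 ∧ MeasurableSet E ∧
      (∀ B ∈ 𝒜 M, B ⊆ E ∨ Disjoint B E) ∧
      ∀ A ∈ 𝒜 N, volume.real A / 4 ≤ volume.real (A ∩ E) ∧
        volume.real A / 4 ≤ volume.real (A \ E) := by
  have hev : ∀ᶠ n in atTop, ∀ A ∈ 𝒜 N, ∀ B ∈ 𝒜 n, volume.real B ≤ volume.real A / 4 := by
    rw [Filter.eventually_all_finite (h.finite N)]
    intro A hA
    have hpos := h.volume_real_pos hA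
    filter_upwards [h.mesh.eventually_lt_const
      (ENNReal.ofReal_pos.mpr (by positivity : 0 < volume.real A / 4))] with n hn B hB
    refine ENNReal.toReal_le_of_le_ofReal (by positivity) (le_trans ?_ hn.le)
    exact le_iSup₂ (f := fun B (_ : B ∈ 𝒜 n) => volume B) B hB
  obtain ⟨M, hM, hNM⟩ := (hev.and (eventually_ge_atTop N)).exists
  choose! a b hab hAeq using h.exists_eq_Ico N
  set S := {B ∈ 𝒜 M | ∃ A ∈ 𝒜 N, B ⊆ Set.Ico (a A) ((a A + b A) / 2)} with hS
  have hhalf : ∀ A ∈ 𝒜 N, Set.Ico (a A) ((a A + b A) / 2) ⊆ A := by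
    intro A hA
    have := hab A hA
    conv_rhs => rw [hAeq A hA]
    exact Set.Ico_subset_Ico_right (by linarith)
  have hSsub : S ⊆ 𝒜 M := fun B hB => hB.1
  have hmeas : MeasurableSet (⋃₀ S) :=
    ((h.finite M).subset hSsub).measurableSet_sUnion fun B hB => h.measurableSet hB.1
  refine ⟨M, hNM, ⋃₀ S, Set.sUnion_subset fun B hB => h.subset_Ico hB.1, hmeas, ?_, ?_⟩
  · intro B hB
    by_cases hBS : B ∈ S
    · exact Or.inl (Set.subset_sUnion_of_mem hBS)
    · refine Or.inr (Set.disjoint_sUnion_right.mpr fun B' hB' => ?_)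
      exact h.pairwiseDisjoint M hB hB'.1 fun e => hBS (e ▸ hB')
  · intro A hA
    have hlt := hab A hA
    have hvol : volume.real A = b A - a A := by
      conv_lhs => rw [hAeq A hA]
      exact Real.volume_real_Ico_of_le hlt.le
    have hup : A ∩ ⋃₀ S ⊆ Set.Ico (a A) ((a A + b A) / 2) := by
      rintro x ⟨hxA, B, ⟨-, A', hA', hBA'⟩, hxB⟩
      have hx' := hBA' hxB
      rwa [h.eq_of_mem hA' hA (hhalf A' hA' hx') hxA] at hx'
    have hlow : Set.Ico (a A) ((a A + b A) / 2 - (b A - a A) / 4) ⊆ A ∩ ⋃₀ S := by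
      intro x hx
      have hxA : x ∈ A := hhalf A hA ⟨hx.1, by linarith [hx.2]⟩
      obtain ⟨B, hB, hxB⟩ := h.exists_mem M (h.subset_Ico hA hxA)
      refine ⟨hxA, B, ⟨hB, A, hA, ?_⟩, hxB⟩
      obtain ⟨A', hA', hBA'⟩ := h.exists_superset hNM B hB
      obtain rfl := h.eq_of_mem hA' hA (hBA' hxB) hxA
      have hBvol := hM A' hA B hB
      obtain ⟨u, v, huv, rfl⟩ := h.exists_eq_Ico M B hB
      rw [hvol, Real.volume_real_Ico_of_le huv.le] at hBvol
      intro y hy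
      have hyA := hBA' hy
      rw [hAeq A' hA] at hyA
      exact ⟨hyA.1, by linarith [hy.2, hxB.1, hx.2]⟩
    have hsplit : volume.real (A ∩ ⋃₀ S) + volume.real (A \ ⋃₀ S) = volume.real A :=
      measureReal_inter_add_sdiff hmeas (h.volume_ne_top hA)
    have h1 : volume.real (A ∩ ⋃₀ S) ≤ (b A - a A) / 2 := by
      refine (measureReal_mono hup (by simp)).trans_eq ?_
      rw [Real.volume_real_Ico_of_le (by linarith)]
      ring
    have h2 : (b A - a A) / 4 ≤ volume.real (A ∩ ⋃₀ S) := by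
      refine Eq.trans_le ?_ (measureReal_mono hlow
        (measure_ne_top_of_subset Set.inter_subset_left (h.volume_ne_top hA)))
      rw [Real.volume_real_Ico_of_le (by linarith)]
      ring
    constructor <;> linarith

/-- A Rademacher-like block: a polynomial with frequencies in `(N, M]`, of norm at most one, with
a substantial integral over a set `E` consisting of intervals of `𝒜 M`. It is the projection of
the indicator of `E` on the orthogonal complement of the step functions of `𝒜 N`. -/
lemma exists_block (h : IsBinaryFiltration 𝒜) (hH : IsMartingaleDifference 𝒜 H)
    (hn : ∀ n, norm2 (H n) = 1) (N : ℕ) :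
    ∃ M, N ≤ M ∧ ∃ E : Set ℝ, E ⊆ Set.Ico 0 1 ∧ MeasurableSet E ∧
      (∀ B ∈ 𝒜 M, B ⊆ E ∨ Disjoint B E) ∧
      ∃ c : ℕ → ℝ, ∑ j ∈ Finset.Ioc N M, c j ^ 2 ≤ 1 ∧
        1 / 8 ≤ ∫ x in E, poly H c (Finset.Ioc N M) x := by
  obtain ⟨M, hNM, E, hE, hEm, hME, hhalf⟩ := h.exists_half N
  set F : ℝ → ℝ := E.indicator 1 with hF
  have hFstep : IsStepAt 𝒜 M F := by
    intro B hB
    rcases hME B hB with hBE | hBE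
    · exact ⟨1, fun x hx => Set.indicator_of_mem (hBE hx) _⟩
    · exact ⟨0, fun x hx => Set.indicator_of_notMem (Set.disjoint_left.mp hBE hx) _⟩
  obtain ⟨c, hc⟩ := hH.exists_eq_poly h hn M F hFstep
  set g := poly H c (Finset.Ioc N M) with hg
  set p := poly H c (Finset.range (N + 1)) with hp
  have hgstep : IsStepAt 𝒜 M g :=
    hH.isStepAt_poly h (fun j hj => (Finset.mem_Ioc.mp hj).2) c
  have hpstep : IsStepAt 𝒜 N p :=
    hH.isStepAt_poly h (fun j hj => Nat.lt_succ_iff.mp (Finset.mem_range.mp hj)) c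
  have hFpg : ∀ x ∈ Set.Ico (0 : ℝ) 1, F x = p x + g x := by
    intro x hx
    rw [hc x hx, hp, hg, poly, poly, poly, ← Finset.sum_union]
    · congr 1
      ext j
      simp only [Finset.mem_range, Finset.mem_union, Finset.mem_Ioc]
      omega
    · rw [Finset.disjoint_left]
      intro j
      simp only [Finset.mem_range, Finset.mem_Ioc]
      omega
  have hgg : ∫ x in Set.Ico 0 1, g x ^ 2 = ∑ j ∈ Finset.Ioc N M, c j ^ 2 := by
    simp only [sq]
    rw [hg, hH.integral_poly_mul_poly h hn]
    exact Finset.sum_congr rfl fun j hj => if_pos hj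
  have hEg : ∫ x in E, g x = ∑ j ∈ Finset.Ioc N M, c j ^ 2 := by
    have e1 : ∫ x in E, g x = ∫ x in Set.Ico 0 1, F x * g x := by
      have : ∀ x, F x * g x = E.indicator g x := fun x => by
        by_cases hx : x ∈ E <;> simp [hF, hx]
      simp only [this]
      rw [setIntegral_indicator hEm, Set.inter_eq_right.mpr hE]
    rw [e1, setIntegral_congr_fun measurableSet_Ico
      (g := fun x => poly H c (Finset.range (M + 1)) x * g x) fun x hx => by
        simp only [hc x hx], hg, hH.integral_poly_mul_poly h hn]
    refine Finset.sum_congr rfl fun j hj => ?_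
    rw [if_pos (Finset.mem_range.mpr (Nat.lt_succ_of_le (Finset.mem_Ioc.mp hj).2)), sq]
  refine ⟨M, hNM, E, hE, hEm, hME, c, ?_, ?_⟩
  · calc ∑ j ∈ Finset.Ioc N M, c j ^ 2 ≤ ∑ j ∈ Finset.range (M + 1), c j ^ 2 :=
          Finset.sum_le_sum_of_subset_of_nonneg (fun j hj =>
            Finset.mem_range.mpr (Nat.lt_succ_of_le (Finset.mem_Ioc.mp hj).2))
            fun j _ _ => sq_nonneg _
      _ = ∫ x in Set.Ico 0 1, F x ^ 2 := by
          rw [setIntegral_congr_fun measurableSet_Ico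
            (g := fun x => poly H c (Finset.range (M + 1)) x * poly H c (Finset.range (M + 1)) x)
            fun x hx => by simp only [hc x hx, sq], hH.integral_poly_mul_poly h hn]
          exact Finset.sum_congr rfl fun j hj => by rw [if_pos hj, sq]
      _ ≤ ∫ x in Set.Ico (0 : ℝ) 1, (1 : ℝ) := by
          refine setIntegral_mono ((hFstep.comp (· ^ 2)).integrableOn h)
            (integrableOn_const (by simp)) fun x => ?_
          by_cases hx : x ∈ E <;> simp [hF, hx]
      _ = 1 := by simp
  · rw [hEg, ← hgg]
    have e : ∫ x in Set.Ico (0 : ℝ) 1, (1 / 8 : ℝ) = 1 / 8 := by simp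
    rw [← e]
    refine h.integral_mono N (integrableOn_const (by simp))
      ((hgstep.comp (· ^ 2)).integrableOn h) fun A hA => ?_
    obtain ⟨v, hv⟩ := hpstep A hA
    obtain ⟨hin, hout⟩ := hhalf A hA
    have hAm := h.measurableSet hA
    have hint : IntegrableOn (fun x => g x ^ 2) A :=
      ((hgstep.comp (· ^ 2)).integrableOn h).mono_set (h.subset_Ico hA)
    have hgA : ∀ x ∈ A, g x = F x - v := fun x hx => by
      rw [hFpg x (h.subset_Ico hA hx), hv x hx]; ring
    rw [← integral_inter_add_sdiff hEm hint, setIntegral_const,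
      setIntegral_congr_fun (hAm.inter hEm) (g := fun _ => (1 - v) ^ 2) (fun x hx => by
        simp only [hgA x hx.1, hF, Set.indicator_of_mem hx.2, Pi.one_apply]),
      setIntegral_congr_fun (hAm.diff hEm) (g := fun _ => v ^ 2) (fun x hx => by
        simp only [hgA x hx.1, hF, Set.indicator_of_notMem hx.2]; ring),
      setIntegral_const, setIntegral_const]
    simp only [smul_eq_mul]
    have k1 := mul_le_mul_of_nonneg_right hin (sq_nonneg (1 - v))
    have k2 := mul_le_mul_of_nonneg_right hout (sq_nonneg v)
    have k3 := mul_nonneg (h.volume_real_pos hA).le (sq_nonneg (2 * v - 1))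
    nlinarith

/-- A monotone family of `2 ^ K` polynomials, in which the maximal function
grows like `K` while the norm is at most `√K`. Think of `K` blocks as the steps of a random walk
and order the binary tree of their pieces so that, at each point, the upward steps come first:
the pieces living off the first set `E` precede the first block, those living on `E` follow it.
The function `L` bounds the maximal function from below. -/
lemma exists_monotone_family (h : IsBinaryFiltration 𝒜) (hH : IsMartingaleDifference 𝒜 H)
    (hn : ∀ n, norm2 (H n) = 1) (K : ℕ) :
    ∀ N : ℕ, ∃ (M : ℕ) (c : ℕ → ℝ) (D : ℕ → Finset ℕ) (L : ℝ → ℝ),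
      N ≤ M ∧ Monotone D ∧ (∀ m, D m ⊆ Finset.Ioc N M) ∧ IntegrableOn L (Set.Ico 0 1) ∧
      (∀ x ∈ Set.Ico (0 : ℝ) 1, ∃ m < 2 ^ K, L x ≤ poly H c (D m) x) ∧
      K / 8 ≤ ∫ x in Set.Ico 0 1, L x ∧ ∑ j ∈ Finset.Ioc N M, c j ^ 2 ≤ K := by
  classical
  induction K with
  | zero =>
    intro N
    refine ⟨N, 0, fun _ => ∅, 0, le_rfl, monotone_const, fun _ => Finset.empty_subset _,
      integrableOn_zero, fun x _ => ⟨0, by simp, by simp [poly]⟩, by simp, by simp⟩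
  | succ K ih =>
    intro N
    obtain ⟨M, hNM, E, hE, hEm, hME, c₀, hc₀, hint₀⟩ := exists_block h hH hn N
    obtain ⟨M', c₁, D, L, hMM', hD, hDsub, hL, hLD, hintL, hc₁⟩ := ih M
    set c : ℕ → ℝ := fun j => if j ≤ M then c₀ j else c₁ j with hc
    set P : ℕ → Prop := fun j => ∀ x ∈ Set.Ico (0 : ℝ) 1, x ∉ E → H j x = 0 with hP
    set g := poly H c₀ (Finset.Ioc N M) with hg
    set U : ℕ → Finset ℕ := fun m => (D (min m (2 ^ K - 1))).filter (¬ P ·) with hU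
    set V : ℕ → Finset ℕ := fun m => (D (m - 2 ^ K)).filter P with hV
    set D' : ℕ → Finset ℕ := fun m =>
      U m ∪ if 2 ^ K ≤ m then Finset.Ioc N M ∪ V m else ∅ with hD'
    have hgt : ∀ m, ∀ j ∈ D m, M < j := fun m j hj => (Finset.mem_Ioc.mp (hDsub m hj)).1
    have hUgt : ∀ m, ∀ j ∈ U m, M < j := fun m j hj => hgt _ j (Finset.mem_filter.mp hj).1
    have hVgt : ∀ m, ∀ j ∈ V m, M < j := fun m j hj => hgt _ j (Finset.mem_filter.mp hj).1
    have hpoly₁ : ∀ G : Finset ℕ, (∀ j ∈ G, M < j) → ∀ x, poly H c G x = poly H c₁ G x :=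
      fun G hG x => Finset.sum_congr rfl fun j hj => by simp [hc, hG j hj]
    have hpoly₀ : ∀ x, poly H c (Finset.Ioc N M) x = g x := fun x =>
      Finset.sum_congr rfl fun j hj => by simp [hc, (Finset.mem_Ioc.mp hj).2]
    have hon : ∀ j, M < j → ¬ P j → ∀ x ∈ E, H j x = 0 := fun j hj hPj =>
      (hH.eq_zero_off_or_on h hj hE hME).resolve_left hPj
    -- on `E` the first group of pieces vanishes, and the last one is all of `D m`
    have hUE : ∀ m, ∀ x ∈ E, poly H c (U m) x = 0 := fun m x hx =>
      Finset.sum_eq_zero fun j hj => by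
        rw [hon j (hUgt m j hj) (Finset.mem_filter.mp hj).2 x hx, mul_zero]
    have hfilter : ∀ (Q : ℕ → Prop) [DecidablePred Q] (m : ℕ) (x : ℝ), (∀ j ∈ D m, ¬ Q j → H j x = 0) →
        poly H c ((D m).filter Q) x = poly H c₁ (D m) x := by
      intro Q _ m x hQ
      rw [hpoly₁ _ fun j hj => hgt m j (Finset.mem_filter.mp hj).1, poly, Finset.sum_filter]
      refine Finset.sum_congr rfl fun j hj => ?_
      split_ifs with hQj
      · rfl
      · rw [hQ j hj hQj, mul_zero]
    refine ⟨M', c, D', fun x => L x + E.indicator g x, hNM.trans hMM', ?_, ?_, ?_, ?_, ?_, ?_⟩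
    · intro m m' hmm'
      refine Finset.union_subset_union (Finset.filter_subset_filter _ (hD ?_)) ?_
      · exact min_le_min_right _ hmm'
      · split_ifs with h1 h2
        · exact Finset.union_subset_union subset_rfl
            (Finset.filter_subset_filter _ (hD (Nat.sub_le_sub_right hmm' _)))
        · exact absurd (h1.trans hmm') h2
        · exact Finset.empty_subset _
        · exact subset_rfl
    · intro m
      have h1 : Finset.Ioc M M' ⊆ Finset.Ioc N M' := Finset.Ioc_subset_Ioc_left hNM
      refine Finset.union_subset (((Finset.filter_subset _ _).trans (hDsub _)).trans h1) ?_
      split_ifs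
      · exact Finset.union_subset (Finset.Ioc_subset_Ioc_right hMM')
          (((Finset.filter_subset _ _).trans (hDsub _)).trans h1)
      · exact Finset.empty_subset _
    · refine hL.add (IntegrableOn.indicator ?_ hEm)
      exact (hH.isStepAt_poly h (fun j hj => (Finset.mem_Ioc.mp hj).2) c₀).integrableOn h
    · intro x hx
      obtain ⟨m, hm, hLm⟩ := hLD x hx
      by_cases hxE : x ∈ E
      · refine ⟨2 ^ K + m, by rw [pow_succ]; omega, ?_⟩
        have hd1 : Disjoint (U (2 ^ K + m)) (Finset.Ioc N M ∪ V (2 ^ K + m)) := by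
          rw [Finset.disjoint_left]
          intro j hj hj'
          rcases Finset.mem_union.mp hj' with hj' | hj'
          · exact absurd (Finset.mem_Ioc.mp hj').2 (not_le.mpr (hUgt _ j hj))
          · exact (Finset.mem_filter.mp hj).2 (Finset.mem_filter.mp hj').2
        have hd2 : Disjoint (Finset.Ioc N M) (V (2 ^ K + m)) := by
          rw [Finset.disjoint_left]
          intro j hj hj'
          exact absurd (Finset.mem_Ioc.mp hj).2 (not_le.mpr (hVgt _ j hj'))
        have hVx : poly H c (V (2 ^ K + m)) x = poly H c₁ (D m) x := by
          simp only [hV, Nat.add_sub_cancel_left]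
          exact hfilter P m x fun j hj hPj => hon j (hgt m j hj) hPj x hxE
        have e : poly H c (D' (2 ^ K + m)) x = g x + poly H c₁ (D m) x := by
          rw [← hVx, ← hpoly₀, ← zero_add (poly H c (Finset.Ioc N M) x + _),
            ← hUE (2 ^ K + m) x hxE]
          simp only [hD', poly, Nat.le_add_right, if_true]
          rw [Finset.sum_union hd1, Finset.sum_union hd2]
        beta_reduce
        rw [e, Set.indicator_of_mem hxE]
        linarith
      · refine ⟨m, by rw [pow_succ]; omega, ?_⟩
        have e : poly H c (D' m) x = poly H c₁ (D m) x := by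
          simp only [hD', hU, if_neg (not_le.mpr hm), Finset.union_empty,
            min_eq_left (Nat.le_sub_one_of_lt hm)]
          exact hfilter (¬ P ·) m x fun j _ hPj => not_not.mp hPj x hx hxE
        beta_reduce
        rw [e, Set.indicator_of_notMem hxE, add_zero]
        exact hLm
    · have hgi : IntegrableOn g (Set.Ico 0 1) :=
        (hH.isStepAt_poly h (fun j hj => (Finset.mem_Ioc.mp hj).2) c₀).integrableOn h
      rw [integral_add hL (hgi.indicator hEm), setIntegral_indicator hEm,
        Set.inter_eq_right.mpr hE]
      push_cast
      linarith
    · have e : Finset.Ioc N M' = Finset.Ioc N M ∪ Finset.Ioc M M' :=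
        (Finset.Ioc_union_Ioc_eq_Ioc hNM hMM').symm
      have hd : Disjoint (Finset.Ioc N M) (Finset.Ioc M M') := by
        rw [Finset.disjoint_left]
        intro j hj hj'
        exact absurd (Finset.mem_Ioc.mp hj).2 (not_le.mpr (Finset.mem_Ioc.mp hj').1)
      rw [e, Finset.sum_union hd, Finset.sum_congr rfl (g := fun j => c₀ j ^ 2) fun j hj => by
        simp [hc, (Finset.mem_Ioc.mp hj).2], Finset.sum_congr (s₁ := Finset.Ioc M M') rfl
        (g := fun j => c₁ j ^ 2) fun j hj => by simp [hc, (Finset.mem_Ioc.mp hj).1]]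
      push_cast
      linarith

lemma le_kappa (h : IsBinaryFiltration 𝒜) (hH : IsMartingaleDifference 𝒜 H)
    (hn : ∀ n, norm2 (H n) = 1) {n : ℕ} (h2 : 2 ≤ n) :
    ENNReal.ofReal (1 / 16 * Real.sqrt (Real.logb 2 n)) ≤ kappa H n := by
  set K := Nat.log 2 n with hK
  have hK1 : 1 ≤ K := Nat.log_pos one_lt_two h2
  have hKn : 2 ^ K ≤ n := Nat.pow_log_le_self 2 (by omega)
  obtain ⟨M, c, D, L, -, hD, hDsub, hL, hLD, hintL, hcK⟩ := exists_monotone_family h hH hn K 0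
  set G : ℕ → Finset ℕ := fun m => D (m - 1) with hG
  have hGmono : Monotone G := fun m m' hmm' => hD (Nat.sub_le_sub_right hmm' 1)
  have hK0 : (1 : ℝ) ≤ K := by exact_mod_cast hK1
  have hsumK : ∑ j ∈ G n, c j ^ 2 ≤ K :=
    (Finset.sum_le_sum_of_subset_of_nonneg (hDsub _) fun j _ _ => sq_nonneg _).trans hcK
  set s : ℝ → ℝ := fun x => ⨆ m : Set.Icc 1 n, |poly H c (G m) x| with hs
  have hs0 : ∀ x, 0 ≤ s x := fun x => Real.iSup_nonneg fun m => abs_nonneg _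
  have hLs : ∀ x ∈ Set.Ico (0 : ℝ) 1, L x ≤ s x := by
    intro x hx
    obtain ⟨m, hm, hLm⟩ := hLD x hx
    have hm' : m + 1 ∈ Set.Icc 1 n := ⟨by omega, by omega⟩
    refine (hLm.trans (le_abs_self _)).trans ?_
    exact le_ciSup (f := fun m : Set.Icc 1 n => |poly H c (G m) x|)
      (Set.finite_range _).bddAbove ⟨m + 1, hm'⟩
  have hne : ∑ j ∈ G n, c j ^ 2 ≠ 0 := by
    intro h0
    have hc0 : ∀ j ∈ G n, c j = 0 := fun j hj =>
      pow_eq_zero_iff two_ne_zero |>.mp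
        ((Finset.sum_eq_zero_iff_of_nonneg fun j _ => sq_nonneg (c j)).mp h0 j hj)
    have hLle : ∀ x ∈ Set.Ico (0 : ℝ) 1, L x ≤ 0 := by
      intro x hx
      obtain ⟨m, hm, hLm⟩ := hLD x hx
      refine hLm.trans_eq (Finset.sum_eq_zero fun j hj => ?_)
      rw [hc0 j (hD (by omega : m ≤ n - 1) hj), zero_mul]
    have := setIntegral_nonpos (μ := volume) measurableSet_Ico hLle
    linarith
  have hnorm : ENNReal.ofReal (K / 8) ≤ norm2 s := by
    have : IsProbabilityMeasure (volume.restrict (Set.Ico (0 : ℝ) 1)) := ⟨by simp⟩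
    have hLm : IntegrableOn (fun x => max (L x) 0) (Set.Ico 0 1) := hL.pos_part
    calc ENNReal.ofReal (K / 8) ≤ ENNReal.ofReal (∫ x in Set.Ico 0 1, max (L x) 0) :=
          ENNReal.ofReal_le_ofReal (hintL.trans
            (setIntegral_mono hL hLm fun x => le_max_left _ _))
      _ = eLpNorm (fun x => max (L x) 0) 1 (volume.restrict (Set.Ico 0 1)) := by
          rw [ofReal_integral_eq_lintegral_ofReal hLm (ae_of_all _ fun x => le_max_right _ _),
            eLpNorm_one_eq_lintegral_enorm]
          refine lintegral_congr fun x => ?_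
          rw [Real.enorm_of_nonneg (le_max_right _ _)]
      _ ≤ eLpNorm (fun x => max (L x) 0) 2 (volume.restrict (Set.Ico 0 1)) :=
          eLpNorm_le_eLpNorm_of_exponent_le one_le_two hLm.aestronglyMeasurable
      _ ≤ norm2 s := by
          refine eLpNorm_mono_ae ?_
          filter_upwards [ae_restrict_mem measurableSet_Ico] with x hx
          rw [Real.norm_of_nonneg (le_max_right _ _), Real.norm_of_nonneg (hs0 x)]
          exact max_le (hLs x hx) (hs0 x)
  have hle : norm2 s / norm2 (poly H c (G n)) ≤ kappa H n :=
    le_iSup_of_le G <| le_iSup_of_le c <| le_iSup_of_le (hGmono.monotoneOn _) <|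
      le_iSup_of_le hne le_rfl
  refine le_trans ?_ hle
  have hpos : 0 < ∑ j ∈ G n, c j ^ 2 :=
    lt_of_le_of_ne (Finset.sum_nonneg fun j _ => sq_nonneg _) hne.symm
  rw [hH.norm2_poly h hn, ENNReal.le_div_iff_mul_le
    (Or.inl (ENNReal.ofReal_pos.mpr (Real.sqrt_pos.mpr hpos)).ne') (Or.inl ENNReal.ofReal_ne_top),
    ← ENNReal.ofReal_mul (by positivity)]
  refine le_trans (ENNReal.ofReal_le_ofReal ?_) hnorm
  -- `log₂ n < K + 1 ≤ 2 K`
  have hlog : Real.logb 2 n ≤ (2 * Real.sqrt K) ^ 2 := by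
    rw [mul_pow, Real.sq_sqrt (by positivity)]
    have h3 : (n : ℝ) ≤ 2 ^ (K + 1) := by
      exact_mod_cast (Nat.lt_pow_succ_log_self one_lt_two n).le
    have h4 : Real.logb 2 n ≤ (K + 1 : ℕ) := by
      rw [Real.logb_le_iff_le_rpow one_lt_two (by positivity), Real.rpow_natCast]
      exact h3
    push_cast at h4
    linarith
  have hl : Real.sqrt (Real.logb 2 n) ≤ 2 * Real.sqrt K :=
    Real.sqrt_le_iff.mpr ⟨by positivity, hlog⟩
  have hq : Real.sqrt (∑ j ∈ G n, c j ^ 2) ≤ Real.sqrt K := Real.sqrt_le_sqrt hsumK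
  calc 1 / 16 * Real.sqrt (Real.logb 2 n) * Real.sqrt (∑ j ∈ G n, c j ^ 2)
      ≤ 1 / 16 * (2 * Real.sqrt K) * Real.sqrt K := by gcongr
    _ = K / 8 := by
        rw [mul_assoc, mul_assoc, Real.mul_self_sqrt (by positivity)]; ring

end Lower

theorem theorem2 :
    ∃ c₁ c₂ : ℝ, 0 < c₁ ∧ 0 < c₂ ∧
      ∀ H : ℕ → ℝ → ℝ, IsGeneralizedHaarSystem H →
        ∀ n : ℕ, 2 ≤ n →
          ENNReal.ofReal (c₁ * Real.sqrt (Real.logb 2 n)) ≤ kappa H n ∧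
            kappa H n ≤ ENNReal.ofReal (c₂ * Real.sqrt (Real.logb 2 n)) := by
  refine ⟨1 / 16, 6, by norm_num, by norm_num, fun H hH n hn => ?_⟩
  obtain ⟨𝒜, h, hd, hnorm⟩ := hH
  exact ⟨le_kappa h hd hnorm hn, kappa_le h hd hnorm hn⟩
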